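/- For an element $e$ of a join-semilattice $S$ (with zero), say that $S$ satisfies $\mathrm{WURP}^{=}(e)$ if there is a positive integer $m$ such that for every set $I$ and all families $(a_i)_{i\in I}$, $(b_i)_{i\in I}$ of elements of $S$ with $e\le a_i\vee b_i$ for all $i\in I$, there are subsets $I_0,\dots,I_{m-1}$ of $I$ with $\bigcup_{u<m} I_u=I$ and a family $(c_{i,j})_{(i,j)\in I\times I}$ of elements of $S$ such that (i) $c_{i,j}\le a_i\vee a_j$ and $c_{i,j}\le b_i\vee b_j$, for all $u<m$ and all $i,j\in I_u$; (ii) $e\le a_j\vee b_i\vee c_{i,j}$, for all $u<m$ and all $i,j\in I_u$; (iii) $c_{i,k}\le c_{i,j}\vee c_{j,k}$, for all $i,j,k\in I$. Theorem. Let $\mathcal V$ be a variety of lattices having at least one non-distributive member, and let $X$ be a set with $|X|\ge\aleph_2$. Let $\mathbf B_{\mathcal V}(X)$ be the bounded lattice in $\mathcal V$ freely generated by chains $s_i<t_i$ ($i\in X$); that is, $\mathbf B_{\mathcal V}(X)$ is a bounded lattice in $\mathcal V$ with elements $s_i\le t_i$ ($i\in X$) such that for every bounded lattice $L\in\mathcal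 V$ and all $x_i\le y_i$ in $L$ ($i\in X$) there is a unique lattice homomorphism $\mathbf B_{\mathcal V}(X)\to L$ that preserves $0$ and $1$ and sends each $s_i$ to $x_i$ and each $t_i$ to $y_i$. Then the join-semilattice of all compact congruences of $\mathbf B_{\mathcal V}(X)$ does not satisfy $\mathrm{WURP}^{=}(\mathbf 1)$, where $\mathbf 1$ is its largest element, i.e. the largest congruence of $\mathbf B_{\mathcal V}(X)$. -/

import Mathlib

universe u v w

/-! ### Lattice terms, lattice varieties -/

/-- Lattice terms with variables in `α`. -/
inductive LatticeTerm (α : Type u) : Type u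
  | var (a : α) : LatticeTerm α
  | inf (p q : LatticeTerm α) : LatticeTerm α
  | sup (p q : LatticeTerm α) : LatticeTerm α

namespace LatticeTerm

/-- Value of a term in a lattice, under an assignment of the variables. -/
def eval {α : Type u} {L : Type v} [Lattice L] (f : α → L) : LatticeTerm α → L
  | var a => f a
  | inf p q => eval f p ⊓ eval f q
  | sup p q => eval f p ⊔ eval f q

/-- Substitution of terms for the variables of a term. -/
def subst {α : Type u} {β : Type v} (f : α → LatticeTerm β) : LatticeTerm α → LatticeTerm β
  | var a => f a
  | inf p q => inf (subst f p) (subst f q)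
  | sup p q => sup (subst f p) (subst f q)

theorem eval_subst {α : Type u} {β : Type v} {L : Type w} [Lattice L]
    (f : α → LatticeTerm β) (g : β → L) (p : LatticeTerm α) :
    eval g (subst f p) = eval (fun a => eval g (f a)) p := by
  induction p with
  | var a => rfl
  | inf p q hp hq => simp [subst, eval, hp, hq]
  | sup p q hp hq => simp [subst, eval, hp, hq]

end LatticeTerm

/-- A variety of lattices, presented by a set of lattice identities `p = q` in countably many
variables. Its members are the lattices that satisfy all these identities. -/
structure LatticeVariety where
  identities : Set (LatticeTerm ℕ × LatticeTerm ℕ)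

namespace LatticeVariety

/-- The lattice `L` belongs to the variety `V`. -/
def Mem (V : LatticeVariety) (L : Type u) [Lattice L] : Prop :=
  ∀ e ∈ V.identities, ∀ f : ℕ → L, e.1.eval f = e.2.eval f

/-- The variety `V` is non-distributive: some member of it is not a distributive lattice. -/
def IsNonDistributive (V : LatticeVariety) : Prop :=
  ∃ (L : Type u) (_ : Lattice L), V.Mem L ∧
    ¬ ∀ x y z : L, x ⊓ (y ⊔ z) = (x ⊓ y) ⊔ (x ⊓ z)

end LatticeVariety

/-! ### The bounded lattice in `V` freely generated by chains `s i < t i` -/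

/-- The generators: `s i` and `t i` for `i : X`, and the constants `0` and `1`. -/
inductive ChainGen (X : Type u) : Type u
  | s (i : X) : ChainGen X
  | t (i : X) : ChainGen X
  | zero : ChainGen X
  | one : ChainGen X

/-- The least congruence on the algebra of terms in the generators whose quotient is a lattice,
satisfies the identities of `V`, has least element `0` and largest element `1`, and satisfies
`s i ≤ t i` for all `i`. -/
inductive ChainRel (V : LatticeVariety) (X : Type u) :
    LatticeTerm (ChainGen X) → LatticeTerm (ChainGen X) → Prop
  | refl (p) : ChainRel V X p p
  | symm {p q} : ChainRel V X p q → ChainRel V X q p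
  | trans {p q r} : ChainRel V X p q → ChainRel V X q r → ChainRel V X p r
  | inf_congr {p p' q q'} : ChainRel V X p p' → ChainRel V X q q' →
      ChainRel V X (.inf p q) (.inf p' q')
  | sup_congr {p p' q q'} : ChainRel V X p p' → ChainRel V X q q' →
      ChainRel V X (.sup p q) (.sup p' q')
  | inf_comm (p q) : ChainRel V X (.inf p q) (.inf q p)
  | sup_comm (p q) : ChainRel V X (.sup p q) (.sup q p)
  | inf_assoc (p q r) : ChainRel V X (.inf (.inf p q) r) (.inf p (.inf q r))
  | sup_assoc (p q r) : ChainRel V X (.sup (.sup p q) r) (.sup p (.sup q r))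
  | sup_inf_self (p q) : ChainRel V X (.sup p (.inf p q)) p
  | inf_sup_self (p q) : ChainRel V X (.inf p (.sup p q)) p
  | identity (e) (he : e ∈ V.identities) (f : ℕ → LatticeTerm (ChainGen X)) :
      ChainRel V X (e.1.subst f) (e.2.subst f)
  | zero_sup (p) : ChainRel V X (.sup (.var .zero) p) p
  | sup_one (p) : ChainRel V X (.sup p (.var .one)) (.var .one)
  | chain (i) : ChainRel V X (.sup (.var (.s i)) (.var (.t i))) (.var (.t i))

/-- The setoid of `ChainRel`. -/
def chainSetoid (V : LatticeVariety) (X : Type u) : Setoid (LatticeTerm (ChainGen X)) where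
  r := ChainRel V X
  iseqv := ⟨.refl, .symm, .trans⟩

/-- The bounded lattice in `V` freely generated by chains `s i < t i`, for `i : X`. -/
def FreeChainLattice (V : LatticeVariety) (X : Type u) : Type u :=
  Quotient (chainSetoid V X)

namespace FreeChainLattice

variable {V : LatticeVariety} {X : Type u}

/-- The element represented by a term. -/
def mk (V : LatticeVariety) {X : Type u} (p : LatticeTerm (ChainGen X)) : FreeChainLattice V X :=
  Quotient.mk (chainSetoid V X) p

theorem mk_eq {p q : LatticeTerm (ChainGen X)} (h : ChainRel V X p q) : mk V p = mk V q :=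
  Quotient.sound (s := chainSetoid V X) h

theorem mk_surjective : Function.Surjective (mk V (X := X)) :=
  Quotient.mk_surjective

instance : Lattice (FreeChainLattice V X) :=
  letI : Max (FreeChainLattice V X) :=
    ⟨Quotient.map₂ LatticeTerm.sup (fun _ _ h _ _ h' => ChainRel.sup_congr h h')⟩
  letI : Min (FreeChainLattice V X) :=
    ⟨Quotient.map₂ LatticeTerm.inf (fun _ _ h _ _ h' => ChainRel.inf_congr h h')⟩
  Lattice.mk'
    (by rintro ⟨p⟩ ⟨q⟩; exact mk_eq (.sup_comm p q))
    (by rintro ⟨p⟩ ⟨q⟩ ⟨r⟩; exact mk_eq (.sup_assoc p q r))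
    (by rintro ⟨p⟩ ⟨q⟩; exact mk_eq (.inf_comm p q))
    (by rintro ⟨p⟩ ⟨q⟩ ⟨r⟩; exact mk_eq (.inf_assoc p q r))
    (by rintro ⟨p⟩ ⟨q⟩; exact mk_eq (.sup_inf_self p q))
    (by rintro ⟨p⟩ ⟨q⟩; exact mk_eq (.inf_sup_self p q))

theorem mk_sup (p q : LatticeTerm (ChainGen X)) : mk V (.sup p q) = mk V p ⊔ mk V q := rfl

theorem mk_inf (p q : LatticeTerm (ChainGen X)) : mk V (.inf p q) = mk V p ⊓ mk V q := rfl

instance : BoundedOrder (FreeChainLattice V X) where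
  bot := mk V (.var .zero)
  bot_le := by
    rintro ⟨p⟩
    exact sup_eq_right.mp (mk_eq (.zero_sup p))
  top := mk V (.var .one)
  le_top := by
    rintro ⟨p⟩
    exact sup_eq_right.mp (mk_eq (.sup_one p))

/-- The generator `s i`. -/
def s (V : LatticeVariety) {X : Type u} (i : X) : FreeChainLattice V X := mk V (.var (.s i))

/-- The generator `t i`. -/
def t (V : LatticeVariety) {X : Type u} (i : X) : FreeChainLattice V X := mk V (.var (.t i))

theorem s_le_t (i : X) : s V i ≤ t V i := sup_eq_right.mp (mk_eq (.chain i))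

theorem mk_subst (f : ℕ → LatticeTerm (ChainGen X)) (p : LatticeTerm ℕ) :
    mk V (p.subst f) = p.eval (fun n => mk V (f n)) := by
  induction p with
  | var a => rfl
  | inf p q hp hq => simp [LatticeTerm.subst, LatticeTerm.eval, mk_inf, hp, hq]
  | sup p q hp hq => simp [LatticeTerm.subst, LatticeTerm.eval, mk_sup, hp, hq]

/-- The lattice belongs to `V`. -/
theorem mem : V.Mem (FreeChainLattice V X) := by
  intro e he f
  obtain ⟨g, hg⟩ : ∃ g : ℕ → LatticeTerm (ChainGen X), (fun n => mk V (g n)) = f :=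
    ⟨fun n => (mk_surjective (f n)).choose, funext fun n => (mk_surjective (f n)).choose_spec⟩
  rw [← hg, ← mk_subst, ← mk_subst]
  exact mk_eq (.identity e he g)

/-- The values of the generators in a bounded lattice. -/
def genVal {L : Type v} [Lattice L] [BoundedOrder L] (a b : X → L) : ChainGen X → L
  | .s i => a i
  | .t i => b i
  | .zero => ⊥
  | .one => ⊤

theorem eval_eq_of_rel {L : Type v} [Lattice L] [BoundedOrder L] (hL : V.Mem L)
    (a b : X → L) (hab : ∀ i, a i ≤ b i) {p q : LatticeTerm (ChainGen X)}
    (h : ChainRel V X p q) : p.eval (genVal a b) = q.eval (genVal a b) := by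
  induction h with
  | refl p => rfl
  | symm _ ih => exact ih.symm
  | trans _ _ ih ih' => exact ih.trans ih'
  | inf_congr _ _ ih ih' => simp only [LatticeTerm.eval, ih, ih']
  | sup_congr _ _ ih ih' => simp only [LatticeTerm.eval, ih, ih']
  | inf_comm p q => exact _root_.inf_comm _ _
  | sup_comm p q => exact _root_.sup_comm _ _
  | inf_assoc p q r => exact _root_.inf_assoc _ _ _
  | sup_assoc p q r => exact _root_.sup_assoc _ _ _
  | sup_inf_self p q => exact _root_.sup_inf_self
  | inf_sup_self p q => exact _root_.inf_sup_self
  | identity e he f =>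
    rw [LatticeTerm.eval_subst, LatticeTerm.eval_subst]
    exact hL e he _
  | zero_sup p => exact bot_sup_eq _
  | sup_one p => exact sup_top_eq _
  | chain i => exact sup_eq_right.mpr (hab i)

/-- The universal property: for every bounded lattice `L` in `V` and all `a i ≤ b i` in `L`, there
is exactly one bound-preserving lattice homomorphism with `s i ↦ a i` and `t i ↦ b i`. -/
theorem existsUnique_hom {L : Type v} [Lattice L] [BoundedOrder L] (hL : V.Mem L)
    (a b : X → L) (hab : ∀ i, a i ≤ b i) :
    ∃! f : BoundedLatticeHom (FreeChainLattice V X) L,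
      (∀ i, f (s V i) = a i) ∧ (∀ i, f (t V i) = b i) := by
  refine ⟨⟨⟨⟨Quotient.lift (fun p => p.eval (genVal a b))
    (fun p q h => eval_eq_of_rel hL a b hab h), ?_⟩, ?_⟩, rfl, rfl⟩,
    ⟨fun _ => rfl, fun _ => rfl⟩, ?_⟩
  · rintro ⟨p⟩ ⟨q⟩; rfl
  · rintro ⟨p⟩ ⟨q⟩; rfl
  · rintro g ⟨hs, ht⟩
    ext x
    obtain ⟨p, rfl⟩ := mk_surjective x
    change g (mk V p) = p.eval (genVal a b)
    induction p with
    | var c =>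
      cases c with
      | s i => exact hs i
      | t i => exact ht i
      | zero => exact map_bot g
      | one => exact map_top g
    | inf p q hp hq => rw [mk_inf, map_inf, hp, hq]; rfl
    | sup p q hp hq => rw [mk_sup, map_sup, hp, hq]; rfl

end FreeChainLattice

/-! ### The lattice of congruences of a lattice and the semilattice of compact congruences -/

namespace LatticeCon

variable {L : Type u} [Lattice L]

theorem r_injective : Function.Injective (fun c : LatticeCon L => c.r) := by
  rintro ⟨⟨r, h⟩, _, _⟩ ⟨⟨r', h'⟩, _, _⟩ hr
  obtain rfl : r = r' := hr
  rfl

/-- Congruences are ordered by containment. -/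
instance : PartialOrder (LatticeCon L) where
  le c d := ∀ ⦃x y : L⦄, c.r x y → d.r x y
  le_refl _ _ _ h := h
  le_trans _ _ _ h h' _ _ hxy := h' (h hxy)
  le_antisymm _ _ h h' := r_injective (funext fun _ => funext fun _ => propext ⟨@h _ _, @h' _ _⟩)

theorem le_def {c d : LatticeCon L} : c ≤ d ↔ ∀ x y : L, c.r x y → d.r x y := Iff.rfl

/-- The infimum of a set of congruences is their intersection. -/
instance : InfSet (LatticeCon L) where
  sInf S :=
    { r := fun x y => ∀ c ∈ S, c.r x y
      iseqv := ⟨fun x c _ => c.refl x, fun h c hc => c.symm (h c hc),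
        fun h h' c hc => c.trans (h c hc) (h' c hc)⟩
      inf := fun h h' c hc => c.inf (h c hc) (h' c hc)
      sup := fun h h' c hc => c.sup (h c hc) (h' c hc) }

instance : CompleteLattice (LatticeCon L) :=
  completeLatticeOfInf (LatticeCon L) fun _ =>
    ⟨fun c hc _ _ h => h c hc, fun _ hd _ _ h _ hc => hd hc h⟩

/-- In a bounded lattice, a congruence that identifies `⊥` and `⊤` is the largest one. -/
theorem eq_top_of_bot_top [BoundedOrder L] (c : LatticeCon L) (h : c.r ⊥ ⊤) : c = ⊤ := by
  have key : ∀ x : L, c.r ⊥ x := fun x => by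
    have := c.inf h (c.refl x)
    simpa using this
  exact top_unique fun x y _ => c.trans (c.symm (key x)) (key y)

theorem isCompactElement_top [BoundedOrder L] : IsCompactElement (⊤ : LatticeCon L) := by
  intro S d hne hdir hd htop
  let e : LatticeCon L :=
    { r := fun x y => ∃ c ∈ S, c.r x y
      iseqv := by
        refine ⟨fun x => ?_, ?_, ?_⟩
        · obtain ⟨c, hc⟩ := hne
          exact ⟨c, hc, c.refl x⟩
        · rintro x y ⟨c, hc, h⟩
          exact ⟨c, hc, c.symm h⟩
        · rintro x y z ⟨c, hc, h⟩ ⟨c', hc', h'⟩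
          obtain ⟨b, hb, h1, h2⟩ := hdir c hc c' hc'
          exact ⟨b, hb, b.trans (h1 h) (h2 h')⟩
      inf := by
        rintro w x y z ⟨c, hc, h⟩ ⟨c', hc', h'⟩
        obtain ⟨b, hb, h1, h2⟩ := hdir c hc c' hc'
        exact ⟨b, hb, b.inf (h1 h) (h2 h')⟩
      sup := by
        rintro w x y z ⟨c, hc, h⟩ ⟨c', hc', h'⟩
        obtain ⟨b, hb, h1, h2⟩ := hdir c hc c' hc'
        exact ⟨b, hb, b.sup (h1 h) (h2 h')⟩ }
  have hde : d ≤ e := hd.2 fun c hc x y h => ⟨c, hc, h⟩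
  have ht : (⊤ : LatticeCon L).r ⊥ ⊤ := fun c hc => absurd hc (Set.notMem_empty c)
  obtain ⟨c, hc, h⟩ := hde (htop ht)
  exact ⟨c, hc, (eq_top_of_bot_top c h).ge⟩

theorem isCompactElement_bot : IsCompactElement (⊥ : LatticeCon L) :=
  fun _ _ hne _ _ _ => hne.imp fun _ hc => ⟨hc, bot_le⟩

theorem isCompactElement_sup {c d : LatticeCon L} (hc : IsCompactElement c)
    (hd : IsCompactElement d) : IsCompactElement (c ⊔ d) := by
  intro S u hne hdir hu hle
  obtain ⟨x, hx, hcx⟩ := hc S u hne hdir hu (le_sup_left.trans hle)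
  obtain ⟨y, hy, hdy⟩ := hd S u hne hdir hu (le_sup_right.trans hle)
  obtain ⟨z, hz, hxz, hyz⟩ := hdir x hx y hy
  exact ⟨z, hz, sup_le (hcx.trans hxz) (hdy.trans hyz)⟩

end LatticeCon

/-- The set of all compact congruences of the lattice `L`, ordered by containment. -/
def CompactCon (L : Type u) [Lattice L] : Type u :=
  {c : LatticeCon L // IsCompactElement c}

namespace CompactCon

variable {L : Type u} [Lattice L]

instance : SemilatticeSup (CompactCon L) :=
  Subtype.semilatticeSup fun _ _ hc hd => LatticeCon.isCompactElement_sup hc hd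

instance : OrderBot (CompactCon L) :=
  Subtype.orderBot LatticeCon.isCompactElement_bot

/-- For a bounded lattice, the largest congruence is compact. -/
instance [BoundedOrder L] : OrderTop (CompactCon L) :=
  Subtype.orderTop LatticeCon.isCompactElement_top

end CompactCon

/-! ### The uniform refinement property -/

/-- The property `WURP⁼(e)` for an element `e` of a join-semilattice `S`. The index sets `I` range
over the universe of `S`; this is no restriction, since each family of pairs `(a i, b i)` is a
reindexing of a family indexed by a subset of `S × S`. -/
def WURPEq {S : Type u} [SemilatticeSup S] (e : S) : Prop :=
  ∃ m : ℕ, 0 < m ∧ ∀ (I : Type u) (a b : I → S), (∀ i, e ≤ a i ⊔ b i) →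
    ∃ (J : Fin m → Set I) (c : I → I → S),
      (⋃ k, J k) = Set.univ ∧
      (∀ k, ∀ i ∈ J k, ∀ j ∈ J k, c i j ≤ a i ⊔ a j ∧ c i j ≤ b i ⊔ b j) ∧
      (∀ k, ∀ i ∈ J k, ∀ j ∈ J k, e ≤ a j ⊔ b i ⊔ c i j) ∧
      (∀ i j k, c i k ≤ c i j ⊔ c j k)

/-! ### Free triples for set mappings on pairs -/

section FreeTriple

open Cardinal Set

/-- Kuratowski's free set theorem for set mappings on pairs, in the form used here: a set mapping
that sends pairs to finite sets has a free triple in every set of cardinality at least `ℵ₂`. -/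
theorem exists_free_triple {X : Type u} (Y : Set X) (hY : aleph 2 ≤ #Y) (F : X → X → Set X)
    (hF : ∀ i j, (F i j).Finite) :
    ∃ i ∈ Y, ∃ j ∈ Y, ∃ k ∈ Y, i ≠ j ∧ i ≠ k ∧ j ≠ k ∧
      k ∉ F i j ∧ i ∉ F j k ∧ j ∉ F i k := by
  have h12 : aleph 1 < #Y := lt_of_lt_of_le (aleph_lt_aleph.2 one_lt_two) hY
  obtain ⟨Z, hZY, hZ⟩ := le_mk_iff_exists_subset.1 h12.le
  have hω : ℵ₀ ≤ aleph 1 := aleph0_le_aleph 1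
  obtain ⟨k, hkY, hk⟩ : ∃ k ∈ Y, k ∉ Z ∪ ⋃ z : Z × Z, F z.1 z.2 := by
    by_contra! h
    refine absurd ((mk_le_mk_of_subset (show Y ⊆ _ from h)).trans
      ((mk_union_le _ _).trans ?_)) h12.not_ge
    refine add_le_of_le hω hZ.le ((mk_iUnion_le _).trans (mul_le_of_le hω ?_ ?_))
    · simp [hZ, mul_eq_self hω]
    · exact ciSup_le' fun z => ((hF z.1 z.2).lt_aleph0.le).trans hω
  simp only [mem_union, mem_iUnion, not_or, not_exists] at hk
  have hZ0 : aleph 0 < #Z := by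
    rw [hZ]
    exact aleph_lt_aleph.2 zero_lt_one
  obtain ⟨W, hWZ, hW⟩ := le_mk_iff_exists_subset.1 hZ0.le
  rw [aleph_zero] at hZ0 hW
  obtain ⟨j, hjZ, hj⟩ : ∃ j ∈ Z, j ∉ W ∪ ⋃ w : W, F w k := by
    by_contra! h
    refine absurd ((mk_le_mk_of_subset (show Z ⊆ _ from h)).trans
      ((mk_union_le _ _).trans ?_)) hZ0.not_ge
    refine add_le_of_le le_rfl hW.le ((mk_iUnion_le _).trans (mul_le_of_le le_rfl hW.le ?_))
    exact ciSup_le' fun z => (hF _ _).lt_aleph0.le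
  simp only [mem_union, mem_iUnion, not_or, not_exists] at hj
  have hWinf : W.Infinite := by
    rw [← infinite_coe_iff, infinite_iff, hW]
  obtain ⟨i, hiW, hi⟩ := (hWinf.sdiff (hF j k)).nonempty
  have hiZ := hWZ hiW
  refine ⟨i, hZY hiZ, j, hZY hjZ, k, hkY, ?_, ?_, ?_, hk.2 (⟨i, hiZ⟩, ⟨j, hjZ⟩), hi,
    hj.2 ⟨i, hiW⟩⟩
  · rintro rfl
    exact hj.1 hiW
  · rintro rfl
    exact hk.1 hiZ
  · rintro rfl
    exact hk.1 hjZ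

theorem exists_aleph_two_le_mk {X : Type u} (hX : aleph 2 ≤ #X) {m : ℕ} (J : Fin m → Set X)
    (hJ : ⋃ u, J u = Set.univ) : ∃ u, aleph 2 ≤ #(J u) := by
  by_contra! h
  have h2 : aleph.{u} 2 = Order.succ (aleph 1) := by
    rw [succ_aleph, one_add_one_eq_two]
  have h12 : aleph.{u} 1 < aleph 2 := aleph_lt_aleph.2 one_lt_two
  have hω : ℵ₀ ≤ aleph.{u} 1 := aleph0_le_aleph 1
  have key : #(⋃ u, J u) ≤ aleph 1 := by
    have := mk_iUnion_le_lift J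
    simp only [lift_uzero, mk_fin, lift_natCast] at this
    refine this.trans (mul_le_of_le hω ((natCast_lt_aleph0).le.trans hω) ?_)
    exact ciSup_le' fun u => Order.lt_succ_iff.1 (h2 ▸ h u)
  rw [hJ, mk_univ] at key
  exact absurd (hX.trans key) h12.not_ge

end FreeTriple

/-! ### Non-distributive lattices -/

/-- A lattice with cancellation (relative complements are unique) is distributive. -/
theorem inf_sup_eq_of_cancel {L : Type v} [Lattice L]
    (h : ∀ p q r : L, p ⊓ q = r ⊓ q → p ⊔ q = r ⊔ q → p = r) (x y z : L) :
    x ⊓ (y ⊔ z) = (x ⊓ y) ⊔ (x ⊓ z) := by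
  have hmod : ∀ {a c : L} (b : L), a ≤ c → (a ⊔ b) ⊓ c ≤ a ⊔ (b ⊓ c) := by
    intro a c b hac
    have h1 : a ⊔ (b ⊓ c) ≤ (a ⊔ b) ⊓ c :=
      sup_le (le_inf le_sup_left hac) (inf_le_inf_right c le_sup_right)
    refine (h (a ⊔ (b ⊓ c)) b ((a ⊔ b) ⊓ c) (le_antisymm (inf_le_inf_right b h1) ?_)
      (le_antisymm (sup_le_sup_right h1 b) ?_)).ge
    · exact le_inf ((le_inf inf_le_right (inf_le_left.trans inf_le_right)).trans le_sup_right)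
        inf_le_right
    · exact sup_le (inf_le_left.trans (sup_le (le_sup_left.trans le_sup_left) le_sup_right))
        le_sup_right
  have : IsModularLattice L := ⟨fun b _ hac => hmod b hac⟩
  have key : x ⊓ (y ⊔ z) ⊔ (y ⊓ z) = z ⊓ (x ⊔ y) ⊔ (x ⊓ y) := by
    refine h _ y _ ?_ ?_
    · have e1 : (x ⊓ (y ⊔ z) ⊔ (y ⊓ z)) ⊓ y = (x ⊓ y) ⊔ (y ⊓ z) := by
        rw [sup_comm, ← sup_inf_assoc_of_le _ (inf_le_left : y ⊓ z ≤ y) |>.symm, sup_comm,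
          inf_assoc, inf_eq_right.2 (le_sup_left : y ≤ y ⊔ z)]
      have e2 : (z ⊓ (x ⊔ y) ⊔ (x ⊓ y)) ⊓ y = (x ⊓ y) ⊔ (y ⊓ z) := by
        rw [sup_comm, ← sup_inf_assoc_of_le _ (inf_le_right : x ⊓ y ≤ y) |>.symm,
          inf_assoc, inf_eq_right.2 (le_sup_right : y ≤ x ⊔ y), inf_comm z y]
      rw [e1, e2]
    · have e1 : x ⊓ (y ⊔ z) ⊔ (y ⊓ z) ⊔ y = (x ⊔ y) ⊓ (y ⊔ z) := by
        rw [sup_assoc, sup_eq_right.2 (inf_le_left : y ⊓ z ≤ y), sup_comm,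
          ← sup_inf_assoc_of_le _ (le_sup_left : y ≤ y ⊔ z), sup_comm y x]
      have e2 : z ⊓ (x ⊔ y) ⊔ (x ⊓ y) ⊔ y = (x ⊔ y) ⊓ (y ⊔ z) := by
        rw [sup_assoc, sup_eq_right.2 (inf_le_right : x ⊓ y ≤ y), sup_comm,
          ← sup_inf_assoc_of_le _ (le_sup_right : y ≤ x ⊔ y), inf_comm]
      rw [e1, e2]
  refine le_antisymm ?_ le_inf_sup
  calc x ⊓ (y ⊔ z) ≤ ((x ⊓ y) ⊔ z ⊓ (x ⊔ y)) ⊓ x :=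
        le_inf ((le_sup_left.trans key.le).trans (sup_comm _ _).le) inf_le_left
    _ ≤ (x ⊓ y) ⊔ (z ⊓ (x ⊔ y)) ⊓ x := hmod _ inf_le_left
    _ ≤ (x ⊓ y) ⊔ (x ⊓ z) :=
        sup_le_sup_left (le_inf inf_le_right (inf_le_left.trans inf_le_left)) _

theorem LatticeTerm.map_eval {α : Type u} {L : Type v} {M : Type w} [Lattice L] [Lattice M]
    (g : LatticeHom L M) (f : α → L) (p : LatticeTerm α) :
    g (p.eval f) = p.eval (fun a => g (f a)) := by
  induction p with
  | var a => rfl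
  | inf p q hp hq => simp only [LatticeTerm.eval, map_inf, hp, hq]
  | sup p q hp hq => simp only [LatticeTerm.eval, map_sup, hp, hq]

namespace LatticeVariety

theorem Mem.of_injective {V : LatticeVariety} {L : Type v} {M : Type w} [Lattice L] [Lattice M]
    (hM : V.Mem M) (g : LatticeHom L M) (hg : Function.Injective g) : V.Mem L := fun e he f =>
  hg (by rw [LatticeTerm.map_eval, LatticeTerm.map_eval]; exact hM e he _)

theorem Mem.bool {V : LatticeVariety} {L : Type v} [Lattice L] [BoundedOrder L] [Nontrivial L]
    (hL : V.Mem L) : V.Mem Bool := by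
  refine hL.of_injective ⟨⟨fun b => cond b ⊤ ⊥, ?_⟩, ?_⟩ ?_
  · rintro (_ | _) (_ | _) <;> simp
  · rintro (_ | _) (_ | _) <;> simp
  · rintro (_ | _) (_ | _) <;> simp [bot_ne_top, top_ne_bot]

/-- A non-distributive variety has a bounded member in which some element `q` has two different
complements. -/
theorem IsNonDistributive.exists_isCompl {V : LatticeVariety} (hV : IsNonDistributive.{v} V) :
    ∃ (L : Type v) (_ : Lattice L) (_ : BoundedOrder L), V.Mem L ∧
      ∃ p q r : L, IsCompl p q ∧ IsCompl r q ∧ ¬ r ≤ p := by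
  obtain ⟨L, _, hL, hd⟩ := hV
  obtain ⟨p, q, r, h1, h2, h3⟩ :
      ∃ p q r : L, p ⊓ q = r ⊓ q ∧ p ⊔ q = r ⊔ q ∧ ¬ r ≤ p := by
    by_contra! h
    exact hd (inf_sup_eq_of_cancel fun p q r h1 h2 =>
      le_antisymm (h r q p h1.symm h2.symm) (h p q r h1 h2))
  have : Fact (p ⊓ q ≤ p ⊔ q) := ⟨inf_le_left.trans le_sup_left⟩
  refine ⟨Set.Icc (p ⊓ q) (p ⊔ q), inferInstance, inferInstance,
    hL.of_injective ⟨⟨Subtype.val, fun _ _ => rfl⟩, fun _ _ => rfl⟩ Subtype.val_injective,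
    ⟨p, inf_le_left, le_sup_left⟩, ⟨q, inf_le_right, le_sup_right⟩,
    ⟨r, h1.le.trans inf_le_left, le_sup_left.trans h2.ge⟩, ?_, ?_, h3⟩
  · exact Set.Icc.isCompl_iff.2 ⟨rfl, rfl⟩
  · exact Set.Icc.isCompl_iff.2 ⟨h1.symm, h2.symm⟩

end LatticeVariety

/-! ### Finitely generated congruences -/

namespace LatticeCon

variable {L : Type u} [Lattice L]

/-- The congruence generated by a set of pairs. -/
def gen (T : Set (L × L)) : LatticeCon L := sInf {c | ∀ z ∈ T, c.r z.1 z.2}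

theorem gen_le {T : Set (L × L)} {d : LatticeCon L} :
    gen T ≤ d ↔ ∀ z ∈ T, d.r z.1 z.2 :=
  ⟨fun h z hz => h fun _ hc => hc z hz, fun h => sInf_le h⟩

theorem gen_mono {T T' : Set (L × L)} (h : T ⊆ T') : gen T ≤ gen T' :=
  gen_le.2 fun z hz => gen_le.1 le_rfl z (h hz)

/-- The union of a nonempty directed set of congruences. -/
def directedUnion (S : Set (LatticeCon L)) (hne : S.Nonempty) (hdir : DirectedOn (· ≤ ·) S) :
    LatticeCon L where
  r x y := ∃ c ∈ S, c.r x y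
  iseqv := by
    refine ⟨fun x => ?_, ?_, ?_⟩
    · obtain ⟨c, hc⟩ := hne
      exact ⟨c, hc, c.refl x⟩
    · rintro x y ⟨c, hc, h⟩
      exact ⟨c, hc, c.symm h⟩
    · rintro x y z ⟨c, hc, h⟩ ⟨c', hc', h'⟩
      obtain ⟨b, hb, h1, h2⟩ := hdir c hc c' hc'
      exact ⟨b, hb, b.trans (h1 h) (h2 h')⟩
  inf := by
    rintro w x y z ⟨c, hc, h⟩ ⟨c', hc', h'⟩
    obtain ⟨b, hb, h1, h2⟩ := hdir c hc c' hc'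
    exact ⟨b, hb, b.inf (h1 h) (h2 h')⟩
  sup := by
    rintro w x y z ⟨c, hc, h⟩ ⟨c', hc', h'⟩
    obtain ⟨b, hb, h1, h2⟩ := hdir c hc c' hc'
    exact ⟨b, hb, b.sup (h1 h) (h2 h')⟩

/-- The principal congruence generated by a pair. -/
def principal (x y : L) : LatticeCon L := gen {(x, y)}

theorem principal_le {x y : L} {d : LatticeCon L} : principal x y ≤ d ↔ d.r x y := by
  simp [principal, gen_le]

theorem isCompactElement_principal (x y : L) : IsCompactElement (principal x y) := by
  intro S u hne hdir hu hle
  have hue : u ≤ directedUnion S hne hdir := hu.2 fun c hc x y h => ⟨c, hc, h⟩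
  obtain ⟨c, hc, h⟩ := hue (principal_le.1 hle)
  exact ⟨c, hc, principal_le.2 h⟩

theorem exists_finite_eq_gen {c : LatticeCon L} (hc : IsCompactElement c) :
    ∃ T : Set (L × L), T.Finite ∧ c = gen T := by
  let S : Set (LatticeCon L) :=
    {d | ∃ T : Set (L × L), T.Finite ∧ (∀ z ∈ T, c.r z.1 z.2) ∧ d = gen T}
  have hdir : DirectedOn (· ≤ ·) S := by
    rintro _ ⟨T, hT, hTc, rfl⟩ _ ⟨T', hT', hTc', rfl⟩
    refine ⟨_, ⟨T ∪ T', hT.union hT', ?_, rfl⟩, gen_mono Set.subset_union_left,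
      gen_mono Set.subset_union_right⟩
    rintro z (hz | hz)
    exacts [hTc z hz, hTc' z hz]
  have hlub : IsLUB S c := by
    refine ⟨?_, fun d hd x y hxy => ?_⟩
    · rintro _ ⟨T, -, hTc, rfl⟩
      exact gen_le.2 hTc
    · have : principal x y ≤ d :=
        hd ⟨{(x, y)}, Set.finite_singleton _, by simpa using hxy, rfl⟩
      exact principal_le.1 this
  obtain ⟨_, ⟨T, hT, hTc, rfl⟩, hle⟩ :=
    hc S c ⟨_, ∅, Set.finite_empty, by simp, rfl⟩ hdir hlub le_rfl
  exact ⟨T, hT, le_antisymm hle (gen_le.2 hTc)⟩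

end LatticeCon

/-! ### Supports of terms and of congruences -/

/-- The set of all indices of generators that occur in a term. -/
def LatticeTerm.indices {X : Type u} : LatticeTerm (ChainGen X) → Set X
  | var (.s i) => {i}
  | var (.t i) => {i}
  | var .zero => ∅
  | var .one => ∅
  | inf p q => indices p ∪ indices q
  | sup p q => indices p ∪ indices q

theorem LatticeTerm.finite_indices {X : Type u} (p : LatticeTerm (ChainGen X)) :
    p.indices.Finite := by
  induction p with
  | var a => cases a <;> simp [LatticeTerm.indices]
  | inf p q hp hq => exact hp.union hq
  | sup p q hp hq => exact hp.union hq

namespace FreeChainLattice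

open LatticeCon

variable {V : LatticeVariety} {X : Type u}

/-- A relation that is compatible with the operations and holds between the values of the
generators with index other than `k` holds between the values of each term that avoids `k`. -/
theorem eval_rel {L : Type v} {M : Type w} [Lattice L] [BoundedOrder L] [Lattice M]
    [BoundedOrder M] (R : L → M → Prop) (hbot : R ⊥ ⊥) (htop : R ⊤ ⊤)
    (hinf : ∀ x x' y y', R x y → R x' y' → R (x ⊓ x') (y ⊓ y'))
    (hsup : ∀ x x' y y', R x y → R x' y' → R (x ⊔ x') (y ⊔ y'))
    {a b : X → L} {a' b' : X → M} {k : X} (ha : ∀ l, l ≠ k → R (a l) (a' l))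
    (hb : ∀ l, l ≠ k → R (b l) (b' l)) (p : LatticeTerm (ChainGen X)) (hp : k ∉ p.indices) :
    R (p.eval (genVal a b)) (p.eval (genVal a' b')) := by
  induction p with
  | var c =>
    cases c with
    | s i => exact ha i fun h => hp h.symm
    | t i => exact hb i fun h => hp h.symm
    | zero => exact hbot
    | one => exact htop
  | inf p q ihp ihq =>
    exact hinf _ _ _ _ (ihp fun h => hp (Or.inl h)) (ihq fun h => hp (Or.inr h))
  | sup p q ihp ihq =>
    exact hsup _ _ _ _ (ihp fun h => hp (Or.inl h)) (ihq fun h => hp (Or.inr h))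

/-- The homomorphism with `s i ↦ a i` and `t i ↦ b i`. -/
def lift {L : Type v} [Lattice L] [BoundedOrder L] (hL : V.Mem L) (a b : X → L)
    (hab : ∀ i, a i ≤ b i) : LatticeHom (FreeChainLattice V X) L where
  toFun := Quotient.lift (fun p => p.eval (genVal a b))
    (fun _ _ h => eval_eq_of_rel hL a b hab h)
  map_sup' := by rintro ⟨p⟩ ⟨q⟩; rfl
  map_inf' := by rintro ⟨p⟩ ⟨q⟩; rfl

/-- The kernel of `lift`. -/
def liftKer {L : Type v} [Lattice L] [BoundedOrder L] (hL : V.Mem L) (a b : X → L)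
    (hab : ∀ i, a i ≤ b i) : LatticeCon (FreeChainLattice V X) :=
  LatticeCon.ker (lift hL a b hab)

section liftKer

variable {L : Type v} [Lattice L] [BoundedOrder L] {hL : V.Mem L} {a b : X → L}
  {hab : ∀ i, a i ≤ b i}

theorem liftKer_mk {p q : LatticeTerm (ChainGen X)} :
    (liftKer hL a b hab).r (mk V p) (mk V q) ↔ p.eval (genVal a b) = q.eval (genVal a b) :=
  Iff.rfl

theorem liftKer_s_t {i : X} : (liftKer hL a b hab).r (s V i) (t V i) ↔ a i = b i := Iff.rfl

theorem liftKer_bot_s {i : X} : (liftKer hL a b hab).r ⊥ (s V i) ↔ ⊥ = a i := Iff.rfl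

theorem liftKer_t_top {i : X} : (liftKer hL a b hab).r (t V i) ⊤ ↔ b i = ⊤ := Iff.rfl

theorem liftKer_bot_top : (liftKer hL a b hab).r ⊥ ⊤ ↔ (⊥ : L) = ⊤ := Iff.rfl

end liftKer

/-- The congruence `c` is generated by pairs of terms whose indices belong to `F`. -/
def IsSupported (c : LatticeCon (FreeChainLattice V X)) (F : Set X) : Prop :=
  ∃ T : Set (LatticeTerm (ChainGen X) × LatticeTerm (ChainGen X)),
    (∀ z ∈ T, z.1.indices ⊆ F ∧ z.2.indices ⊆ F) ∧
    ∀ d : LatticeCon (FreeChainLattice V X), c ≤ d ↔ ∀ z ∈ T, d.r (mk V z.1) (mk V z.2)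

theorem exists_finite_isSupported {c : LatticeCon (FreeChainLattice V X)}
    (hc : IsCompactElement c) : ∃ F : Set X, F.Finite ∧ IsSupported c F := by
  obtain ⟨T, hT, rfl⟩ := exists_finite_eq_gen hc
  choose g hg using mk_surjective (V := V) (X := X)
  refine ⟨⋃ z ∈ T, (g z.1).indices ∪ (g z.2).indices,
    hT.biUnion fun z _ => (g z.1).finite_indices.union (g z.2).finite_indices,
    (fun z => (g z.1, g z.2)) '' T, ?_, fun d => ?_⟩
  · rintro _ ⟨z, hz, rfl⟩
    have := Set.subset_biUnion_of_mem
      (u := fun z : FreeChainLattice V X × FreeChainLattice V X =>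
        (g z.1).indices ∪ (g z.2).indices) hz
    exact ⟨Set.subset_union_left.trans this, Set.subset_union_right.trans this⟩
  · rw [Set.forall_mem_image, gen_le]
    simp only [hg]

/-- The congruence that collapses the intervals `[0, s i]` and `[t i, 1]`. -/
def outer (V : LatticeVariety) {X : Type u} (i : X) : LatticeCon (FreeChainLattice V X) :=
  principal ⊥ (s V i) ⊔ principal (t V i) ⊤

/-- The congruence that collapses the interval `[s i, t i]`. -/
def inner (V : LatticeVariety) {X : Type u} (i : X) : LatticeCon (FreeChainLattice V X) :=
  principal (s V i) (t V i)

theorem outer_le {i : X} {d : LatticeCon (FreeChainLattice V X)} :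
    outer V i ≤ d ↔ d.r ⊥ (s V i) ∧ d.r (t V i) ⊤ := by
  rw [outer, sup_le_iff, principal_le, principal_le]

theorem inner_le {i : X} {d : LatticeCon (FreeChainLattice V X)} :
    inner V i ≤ d ↔ d.r (s V i) (t V i) := principal_le

theorem isCompactElement_outer (i : X) : IsCompactElement (outer V i) :=
  isCompactElement_sup (isCompactElement_principal _ _) (isCompactElement_principal _ _)

theorem isCompactElement_inner (i : X) : IsCompactElement (inner V i) :=
  isCompactElement_principal _ _

theorem outer_sup_inner (i : X) : outer V i ⊔ inner V i = ⊤ := by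
  obtain ⟨h1, h2⟩ := outer_le.1 (le_sup_left : outer V i ≤ outer V i ⊔ inner V i)
  have h3 := inner_le.1 (le_sup_right : inner V i ≤ outer V i ⊔ inner V i)
  exact eq_top_of_bot_top _ (Setoid.trans' _ (Setoid.trans' _ h1 h3) h2)

section Separation

open Classical in
/-- If `i` and `j` are sent to the chains `0 ≤ p` and `q ≤ 1` with `p`, `q` complementary, then a
congruence below both `outer i ⊔ outer j` and `inner i ⊔ inner j` that does not depend on `k` is
collapsed. -/
theorem le_liftKer_of_isCompl {L : Type v} [Lattice L] [BoundedOrder L] [Nontrivial L]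
    {hL : V.Mem L} {a b : X → L} {hab : ∀ i, a i ≤ b i} {i j k : X} (hij : i ≠ j)
    {p q : L} (hpq : IsCompl p q) (ha : ∀ l, l ≠ k → a l = if l = j then q else ⊥)
    (hb : ∀ l, l ≠ k → b l = if l = i then p else ⊤)
    {c : LatticeCon (FreeChainLattice V X)} {F : Set X} (hF : IsSupported c F) (hk : k ∉ F)
    (ho : c ≤ outer V i ⊔ outer V j) (hi : c ≤ inner V i ⊔ inner V j) :
    c ≤ liftKer hL a b hab := by
  obtain ⟨T, hTF, hT⟩ := hF
  have h1 : c ≤ liftKer (V := V) (X := X) hL.bool (fun _ => ⊥) (fun _ => ⊤) (fun _ => bot_le) :=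
    ho.trans (sup_le (outer_le.2 ⟨liftKer_bot_s.2 rfl, liftKer_t_top.2 rfl⟩)
      (outer_le.2 ⟨liftKer_bot_s.2 rfl, liftKer_t_top.2 rfl⟩))
  have h2 : c ≤ liftKer (V := V) (X := X) hL.bool (fun l => if l = j then ⊤ else ⊥)
      (fun l => if l = i then ⊥ else ⊤) (fun l => by
        by_cases h : l = j
        · simp [h, hij.symm]
        · simp [h]) :=
    hi.trans (sup_le (inner_le.2 (liftKer_s_t.2 (by simp [hij])))
      (inner_le.2 (liftKer_s_t.2 (by simp [hij.symm]))))
  have key : ∀ w : LatticeTerm (ChainGen X), k ∉ w.indices →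
      w.eval (genVal a b) = (cond (w.eval (genVal (fun _ => ⊥) (fun _ => ⊤))) p ⊥) ⊔
        (cond (w.eval (genVal (fun l => if l = j then ⊤ else ⊥)
          (fun l => if l = i then ⊥ else ⊤))) q ⊥) := by
    intro w hw
    induction w with
    | var e =>
      cases e with
      | s l =>
        have hl : l ≠ k := fun h => hw h.symm
        rw [LatticeTerm.eval, genVal, ha l hl]
        by_cases h : l = j <;> simp [LatticeTerm.eval, genVal, h]
      | t l =>
        have hl : l ≠ k := fun h => hw h.symm
        rw [LatticeTerm.eval, genVal, hb l hl]
        by_cases h : l = i <;> simp [LatticeTerm.eval, genVal, h, hpq.sup_eq_top]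
      | zero => simp [LatticeTerm.eval, genVal]
      | one => simp [LatticeTerm.eval, genVal, hpq.sup_eq_top]
    | inf w w' ih ih' =>
      rw [LatticeTerm.eval, LatticeTerm.eval, LatticeTerm.eval, ih fun h => hw (Or.inl h),
        ih' fun h => hw (Or.inr h)]
      generalize w.eval (genVal (fun _ => (⊥ : Bool)) (fun _ => ⊤)) = x
      generalize w'.eval (genVal (fun _ => (⊥ : Bool)) (fun _ => ⊤)) = x'
      generalize (w.eval _ : Bool) = y
      generalize (w'.eval _ : Bool) = y'
      cases x <;> cases x' <;> cases y <;> cases y' <;>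
        simp [hpq.sup_eq_top, hpq.inf_eq_bot, hpq.symm.inf_eq_bot]
    | sup w w' ih ih' =>
      rw [LatticeTerm.eval, LatticeTerm.eval, LatticeTerm.eval, ih fun h => hw (Or.inl h),
        ih' fun h => hw (Or.inr h)]
      generalize w.eval (genVal (fun _ => (⊥ : Bool)) (fun _ => ⊤)) = x
      generalize w'.eval (genVal (fun _ => (⊥ : Bool)) (fun _ => ⊤)) = x'
      generalize (w.eval _ : Bool) = y
      generalize (w'.eval _ : Bool) = y'
      cases x <;> cases x' <;> cases y <;> cases y' <;>
        simp [hpq.sup_eq_top, hpq.symm.sup_eq_top]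
  refine (hT _).2 fun z hz => liftKer_mk.2 ?_
  rw [key z.1 fun h => hk ((hTF z hz).1 h), key z.2 fun h => hk ((hTF z hz).2 h),
    liftKer_mk.1 ((hT _).1 h1 z hz), liftKer_mk.1 ((hT _).1 h2 z hz)]

open Classical in
/-- If `i` and `k` are sent to the chains `0 ≤ p` and `0 ≤ r` with `r ≰ p`, then a congruence that
does not depend on `j` and whose join with `outer k ⊔ inner i` is everything is not collapsed. -/
theorem not_le_liftKer {L : Type v} [Lattice L] [BoundedOrder L] {hL : V.Mem L} {a b : X → L}
    {hab : ∀ i, a i ≤ b i} {i j k : X} (hik : i ≠ k) {p r : L} (hrp : ¬ r ≤ p)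
    (ha : ∀ l, l ≠ j → a l = ⊥)
    (hb : ∀ l, l ≠ j → b l = if l = i then p else if l = k then r else ⊤)
    {c : LatticeCon (FreeChainLattice V X)} {F : Set X} (hF : IsSupported c F) (hj : j ∉ F)
    (hc : ⊤ ≤ outer V k ⊔ inner V i ⊔ c) :
    ¬ c ≤ liftKer hL a b hab := by
  intro hle
  have : Nontrivial L := ⟨⟨r, p, fun h => hrp h.le⟩⟩
  obtain ⟨T, hTF, hT⟩ := hF
  let R : L → Bool → Prop := fun x y => (y = true → r ≤ x) ∧ (y = false → x ≤ p)
  have hR : ∀ {x y y'}, R x y → R x y' → y = y' := by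
    rintro x (_ | _) (_ | _) ⟨h1, h2⟩ ⟨h3, h4⟩
    exacts [rfl, absurd ((h3 rfl).trans (h2 rfl)) hrp, absurd ((h1 rfl).trans (h4 rfl)) hrp, rfl]
  have key : ∀ w : LatticeTerm (ChainGen X), j ∉ w.indices →
      R (w.eval (genVal a b))
        (w.eval (genVal (fun _ => ⊥) (fun l => if l = i then ⊥ else ⊤))) := by
    refine eval_rel R (by simp [R]) (by simp [R]) ?_ ?_ (fun l hl => ?_) (fun l hl => ?_)
    · rintro x x' (_ | _) (_ | _) ⟨h1, h2⟩ ⟨h3, h4⟩ <;> simp [R] at *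
      exacts [inf_le_left.trans h2, inf_le_left.trans h2, inf_le_right.trans h4, ⟨h1, h3⟩]
    · rintro x x' (_ | _) (_ | _) ⟨h1, h2⟩ ⟨h3, h4⟩ <;> simp [R] at *
      exacts [⟨h2, h4⟩, h3.trans le_sup_right, h1.trans le_sup_left, h1.trans le_sup_left]
    · simp [R, ha l hl]
    · rw [hb l hl]
      by_cases h : l = i
      · simp [R, h]
      · by_cases h' : l = k
        · simp [R, h', hik.symm]
        · simp [R, h, h']
  have h3 : (⊤ : LatticeCon (FreeChainLattice V X)) ≤ liftKer (V := V) (X := X) hL.bool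
      (fun _ => ⊥) (fun l => if l = i then ⊥ else ⊤) (fun _ => bot_le) := by
    refine hc.trans (sup_le (sup_le (outer_le.2 ⟨liftKer_bot_s.2 rfl, liftKer_t_top.2 ?_⟩)
      (inner_le.2 (liftKer_s_t.2 ?_))) ((hT _).2 fun z hz => liftKer_mk.2 ?_))
    · simp [hik.symm]
    · simp
    · have e := liftKer_mk.1 ((hT _).1 hle z hz)
      have k1 := key z.1 fun h => hj ((hTF z hz).1 h)
      have k2 := key z.2 fun h => hj ((hTF z hz).2 h)
      rw [e] at k1
      exact hR k1 k2
  have : (⊤ : LatticeCon (FreeChainLattice V X)).r ⊥ ⊤ :=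
    fun c hc => absurd hc (Set.notMem_empty c)
  exact Bool.false_ne_true (liftKer_bot_top.1 (h3 this))

end Separation

end FreeChainLattice

theorem theoremT (V : LatticeVariety) (hV : LatticeVariety.IsNonDistributive.{v} V)
    (X : Type u) (hX : Cardinal.aleph 2 ≤ Cardinal.mk X) :
    ¬ WURPEq (⊤ : CompactCon (FreeChainLattice V X)) := by
  classical
  rintro ⟨m, -, h⟩
  obtain ⟨J, c, hJ, hc1, hc2, hc3⟩ := h X
    (fun i => ⟨FreeChainLattice.outer V i, FreeChainLattice.isCompactElement_outer i⟩)
    (fun i => ⟨FreeChainLattice.inner V i, FreeChainLattice.isCompactElement_inner i⟩)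
    (fun i => (FreeChainLattice.outer_sup_inner i).ge)
  obtain ⟨u, hu⟩ := exists_aleph_two_le_mk hX J hJ
  choose F hFfin hF using fun i j => FreeChainLattice.exists_finite_isSupported (c i j).2
  obtain ⟨i, hi, j, hj, k, hk, hij, hik, hjk, hkF, hiF, hjF⟩ :=
    exists_free_triple (J u) hu F hFfin
  obtain ⟨L, _, _, hL, p, q, r, hpq, hrq, hrp⟩ := hV.exists_isCompl
  have : Nontrivial L := ⟨⟨r, p, fun h => hrp h.le⟩⟩
  let a : X → L := fun l => if l = j then q else ⊥
  let b : X → L := fun l => if l = i then p else if l = k then r else ⊤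
  have hab : ∀ l, a l ≤ b l := fun l => by
    by_cases h : l = j
    · simp [a, b, h, hij.symm, hjk]
    · simp [a, h]
  have h1 : (c i j).1 ≤ FreeChainLattice.liftKer hL a b hab :=
    FreeChainLattice.le_liftKer_of_isCompl hij hpq (fun _ _ => rfl)
      (fun l hl => by simp [b, hl]) (hF i j) hkF (hc1 u i hi j hj).1 (hc1 u i hi j hj).2
  have h2 : (c j k).1 ≤ FreeChainLattice.liftKer hL a b hab :=
    FreeChainLattice.le_liftKer_of_isCompl hjk.symm hrq (fun _ _ => rfl)
      (fun l hl => by simp [b, hl]) (hF j k) hiF ((hc1 u j hj k hk).1.trans (sup_comm _ _).le)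
      ((hc1 u j hj k hk).2.trans (sup_comm _ _).le)
  exact FreeChainLattice.not_le_liftKer hik hrp (fun l hl => by simp [a, hl]) (fun _ _ => rfl)
    (hF i k) hjF (hc2 u i hi k hk) ((show (c i k).1 ≤ (c i j).1 ⊔ (c j k).1 from hc3 i j k).trans
      (sup_le h1 h2))
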